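/- Let $\mathcal G=(\mathcal V,\mathcal E)$ be a finite simple undirected graph with $\mathcal V=\{1,\dots,N\}$ and edge weights $A_e=A_{ij}>0$ for $e=\{i,j\}\in\mathcal E$. Let $\mathbf x^{(i)}\in\mathbb R^d$ with $\|\mathbf x^{(i)}\|=1$ for $i\in\mathcal V$, let $\mathcal M\subseteq\mathcal V$ be a nonempty set of $M$ labeled nodes with labels $y^{(i)}\in\{-1,1\}$, $i\in\mathcal M$, put $\widetilde{\mathbf x}^{(i)}=y^{(i)}\mathbf x^{(i)}$, and let $\lambda\ge 0$. For $\mathbf w=(\mathbf w^{(1)},\dots,\mathbf w^{(N)})\in\mathbb R^{dN}$ and $\mathbf u=(\mathbf u^{(e)})_{e\in\mathcal E}\in\mathbb R^{dE}$, $E=|\mathcal E|$, let $$h(\mathbf w)=\frac1M\sum_{i\in\mathcal M}\log\bigl(1+\exp(-(\mathbf w^{(i)})^T\widetilde{\mathbf x}^{(i)})\bigr),\qquad g(\mathbf u)=\lambda\sum_{e\in\mathcal E}\|\mathbf u^{(e)}\|,$$ and let $\mathbf D\in\mathbb R^{dE\times dN}$ have the blocks $\mathbf D_{e,i}=A_e\mathbf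 I_d$ and $\mathbf D_{e,j}=-A_e\mathbf I_d$ for $e=\{i,j\}$, $i<j$, and zero blocks otherwise. The logistic network Lasso problem is $$\min_{\mathbf w}\; h(\mathbf w)+\lambda\sum_{\{i,j\}\in\mathcal E}A_{ij}\|\mathbf w^{(j)}-\mathbf w^{(i)}\|\;=\;\min_{\mathbf w}\;h(\mathbf w)+g(\mathbf D\mathbf w),$$ and its saddle-point form is $$\min_{\mathbf w\in\mathbb R^{dN}}\max_{\mathbf u\in\mathbb R^{dE}}\;\mathbf u^T\mathbf D\mathbf w+h(\mathbf w)-g^*(\mathbf u),$$ where $g^*$ is the convex conjugate of $g$. Assume that the logistic network Lasso problem has a minimizer. Let $\boldsymbol\Sigma\in\mathbb R^{dE\times dE}$ be symmetric positive definite and $\mathbf T=\mathrm{diag}\{\tau^{(i)}\mathbf I_d\}_{i=1}^N$ with $\tau^{(i)}>0$ for all $i$ and $\tau^{(i)}<M/\|\mathbf x^{(i)}\|^2$ for $i\in\mathcal M$, and suppose that, in the operator norm induced by the Euclidean norms, $\|\boldsymbol\Sigma^{1/2}\mathbf D\mathbf T^{1/2}\|<1$. Put $\beta_i=\tau^{(i)}\|\mathbf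 x^{(i)}\|^2/M$ and $\sigma(z)=1/(1+\exp(-z))$. Let $(\mathbf w_1,\mathbf u_1)$ be arbitrary, and for $k=1,2,\dots$ let $\overline{\mathbf w}_k=\mathbf w_k-\mathbf T\mathbf D^T\mathbf u_k$ and $$\mathbf w_{k+1}^{(i)}=\begin{cases}\underbrace{\Phi_k^{(i)}\circ\cdots\circ\Phi_k^{(i)}}_{\lceil 2\log(k)/\log(1/\beta_i)\rceil}(\overline{\mathbf w}_k^{(i)}),& i\in\mathcal M,\\ \overline{\mathbf w}_k^{(i)},& i\notin\mathcal M,\end{cases}\qquad \Phi_k^{(i)}(\mathbf v)=\overline{\mathbf w}_k^{(i)}+\frac{\tau^{(i)}}{M}\,\sigma(-\mathbf v^T\widetilde{\mathbf x}^{(i)})\,\widetilde{\mathbf x}^{(i)},$$ $$\mathbf u_{k+1}=(\mathbf I+\boldsymbol\Sigma\,\partial g^*)^{-1}\bigl(\mathbf u_k+\boldsymbol\Sigma\mathbf D(2\mathbf w_{k+1}-\mathbf w_k)\bigr).$$ Then: 1. The resolvent $(\mathbf I+\boldsymbol\Sigma\,\partial g^*)^{-1}$ is defined everywhere and single-valued,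 so that the iteration is well defined. 2. For every $k\ge1$ the exact primal update $\mathbf p_k=(\mathbf I+\mathbf T\,\partial h)^{-1}(\overline{\mathbf w}_k)$ exists and is unique, and $\|\mathbf w_{k+1}^{(i)}-\mathbf p_k^{(i)}\|\le 1/k^2$ for every $i\in\mathcal V$. 3. The sequence $(\mathbf w_k,\mathbf u_k)$ converges to a saddle point $(\widehat{\mathbf w},\widehat{\mathbf u})$ of the saddle-point problem, and $\widehat{\mathbf w}$ is a minimizer of the logistic network Lasso problem. -/

import Mathlib

noncomputable section

open scoped Matrix

/-! ### Convex analysis on Euclidean space -/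

/-- The convex conjugate `f*(y) = sup_x (yᵀ x - f x)`, with values in `[-∞, ∞]`. -/
def convexConjugate {ι : Type*} [Fintype ι] (f : EuclideanSpace ℝ ι → ℝ)
    (y : EuclideanSpace ℝ ι) : EReal :=
  ⨆ x : EuclideanSpace ℝ ι, ((inner ℝ y x - f x : ℝ) : EReal)

/-- The subdifferential `∂f(x) = {q | f z ≥ f x + qᵀ (z - x) for all z}`. -/
def subdifferential {ι : Type*} [Fintype ι] (f : EuclideanSpace ℝ ι → EReal)
    (x : EuclideanSpace ℝ ι) : Set (EuclideanSpace ℝ ι) :=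
  {q | ∀ z, f x + ((inner ℝ q (z - x) : ℝ) : EReal) ≤ f z}

/-- The product of a matrix with a Euclidean vector. -/
def matVec {ι κ : Type*} [Fintype κ] (B : Matrix ι κ ℝ) (v : EuclideanSpace ℝ κ) :
    EuclideanSpace ℝ ι :=
  WithLp.toLp 2 (B *ᵥ v.ofLp)

/-- The set `(I + S ∂f)⁻¹(v)` of all points `p` with `v ∈ p + S ∂f(p)`. -/
def proxResolvent {ι : Type*} [Fintype ι] (S : Matrix ι ι ℝ) (f : EuclideanSpace ℝ ι → EReal)
    (v : EuclideanSpace ℝ ι) : Set (EuclideanSpace ℝ ι) :=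
  {p | ∃ q ∈ subdifferential f p, v = p + matVec S q}

/-- The block with index `i` of a stacked vector with blocks of length `d`. -/
def block {ι : Type*} {d : ℕ} (w : EuclideanSpace ℝ (ι × Fin d)) (i : ι) :
    EuclideanSpace ℝ (Fin d) :=
  WithLp.toLp 2 fun a => w (i, a)

open scoped MatrixOrder Matrix.Norms.L2Operator in
/-- `‖S^{1/2} B T^{1/2}‖`, with positive semidefinite square roots and the norm that is induced
by the Euclidean norms (the largest singular value). -/
def precondNorm {ι κ : Type*} [Fintype ι] [DecidableEq ι] [Fintype κ] [DecidableEq κ]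
    (S : Matrix ι ι ℝ) (B : Matrix ι κ ℝ) (T : Matrix κ κ ℝ) : ℝ :=
  ‖CFC.sqrt S * B * CFC.sqrt T‖

/-- The logistic loss `ℓ(z) = log (1 + exp (-z))`. -/
def logisticLoss (z : ℝ) : ℝ := Real.log (1 + Real.exp (-z))

/-! ### The logistic network Lasso -/

/-- An instance of the logistic network Lasso over the graph `G`. Only the labels of the nodes
in the training set are known, and only these are used. -/
structure LnLasso {N : ℕ} (G : SimpleGraph (Fin N)) (d : ℕ) where
  /-- edge weights -/
  A : G.edgeSet → ℝ
  A_pos : ∀ e, 0 < A e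
  /-- feature vectors -/
  x : Fin N → EuclideanSpace ℝ (Fin d)
  norm_x : ∀ i, ‖x i‖ = 1
  /-- training set -/
  train : Finset (Fin N)
  train_nonempty : train.Nonempty
  /-- labels -/
  y : Fin N → ℝ
  y_eq : ∀ i ∈ train, y i = 1 ∨ y i = -1
  /-- regularization parameter -/
  lam : ℝ
  lam_nonneg : 0 ≤ lam

namespace LnLasso

variable {N d : ℕ} {G : SimpleGraph (Fin N)} [DecidableRel G.Adj] (P : LnLasso G d)

/-- The number `M` of labeled nodes, as a real number. -/
def M : ℝ := (P.train.card : ℝ)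

/-- The vectors `x̃⁽ⁱ⁾ = y⁽ⁱ⁾ x⁽ⁱ⁾`. -/
def xt (i : Fin N) : EuclideanSpace ℝ (Fin d) := P.y i • P.x i

/-- The empirical risk `h(w) = (1/M) ∑_{i ∈ train} ℓ((w⁽ⁱ⁾)ᵀ x̃⁽ⁱ⁾)`. -/
def empRisk (w : EuclideanSpace ℝ (Fin N × Fin d)) : ℝ :=
  1 / P.M * ∑ i ∈ P.train, logisticLoss (inner ℝ (block w i) (P.xt i))

/-- The total variation `∑_{ {i,j} ∈ E } A_{ij} ‖w⁽ʲ⁾ - w⁽ⁱ⁾‖`. -/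
def totalVariation (w : EuclideanSpace ℝ (Fin N × Fin d)) : ℝ :=
  ∑ e : G.edgeSet, P.A e *
    Sym2.lift ⟨fun i j => ‖block w j - block w i‖, fun _ _ => norm_sub_rev _ _⟩ (e : Sym2 (Fin N))

/-- The objective function of the logistic network Lasso. -/
def objective (w : EuclideanSpace ℝ (Fin N × Fin d)) : ℝ :=
  P.empRisk w + P.lam * P.totalVariation w

/-- The weighted block incidence matrix `D`: the block `D_{e,i}` is `A_e I_d` if `e = {i,j}` with
`i < j`, it is `-A_e I_d` if `e = {i,j}` with `i > j`, and `0` otherwise. -/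
def D : Matrix (G.edgeSet × Fin d) (Fin N × Fin d) ℝ :=
  Matrix.of fun ea ib =>
    (if ∃ j, (ea.1 : Sym2 (Fin N)) = s(ib.1, j) ∧ ib.1 < j then P.A ea.1
      else if ∃ j, (ea.1 : Sym2 (Fin N)) = s(ib.1, j) ∧ j < ib.1 then -P.A ea.1
      else 0) * (1 : Matrix (Fin d) (Fin d) ℝ) ea.2 ib.2

/-- `g(u) = λ ∑_e ‖u⁽ᵉ⁾‖`. -/
def g (u : EuclideanSpace ℝ (G.edgeSet × Fin d)) : ℝ :=
  P.lam * ∑ e : G.edgeSet, ‖block u e‖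

/-- The function `uᵀ D w + h(w) - g*(u)` of the saddle-point problem (`-∞` where `g*` is `∞`). -/
def lagrangian (w : EuclideanSpace ℝ (Fin N × Fin d)) (u : EuclideanSpace ℝ (G.edgeSet × Fin d)) :
    EReal :=
  ((inner ℝ u (matVec P.D w) + P.empRisk w : ℝ) : EReal) - convexConjugate P.g u

/-- `(w, u)` is a saddle point: `w` minimizes and `u` maximizes the Lagrangian. -/
def IsSaddlePoint (w : EuclideanSpace ℝ (Fin N × Fin d))
    (u : EuclideanSpace ℝ (G.edgeSet × Fin d)) : Prop :=
  (∀ u', P.lagrangian w u' ≤ P.lagrangian w u) ∧ (∀ w', P.lagrangian w u ≤ P.lagrangian w' u)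

/-! ### The primal-dual iterations -/

/-- `T = diag {τ⁽ⁱ⁾ I_d}`. -/
def T (d : ℕ) (τ : Fin N → ℝ) : Matrix (Fin N × Fin d) (Fin N × Fin d) ℝ :=
  Matrix.diagonal fun ia => τ ia.1

/-- `w̄ = w - T Dᵀ u`, the argument of the primal resolvent. -/
def wbar (τ : Fin N → ℝ) (w : EuclideanSpace ℝ (Fin N × Fin d))
    (u : EuclideanSpace ℝ (G.edgeSet × Fin d)) : EuclideanSpace ℝ (Fin N × Fin d) :=
  w - matVec (T d τ) (matVec P.Dᵀ u)

/-- `Φ⁽ⁱ⁾(v) = c + (τ⁽ⁱ⁾/M) x̃⁽ⁱ⁾ σ(-vᵀ x̃⁽ⁱ⁾)`, where `c` stands for `w̄⁽ⁱ⁾` and `σ` is the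
sigmoid function. -/
def Phi (τ : Fin N → ℝ) (i : Fin N) (c v : EuclideanSpace ℝ (Fin d)) :
    EuclideanSpace ℝ (Fin d) :=
  c + (τ i / P.M * Real.sigmoid (-inner ℝ v (P.xt i))) • P.xt i

/-- `β_i = τ⁽ⁱ⁾ ‖x⁽ⁱ⁾‖² / M`. -/
def beta (τ : Fin N → ℝ) (i : Fin N) : ℝ := τ i * ‖P.x i‖ ^ 2 / P.M

/-- The number `⌈2 log k / log (1/β_i)⌉` of fixed-point iterations in step `k ≥ 1`. -/
def innerSteps (τ : Fin N → ℝ) (i : Fin N) (k : ℕ) : ℕ :=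
  ⌈2 * Real.log k / Real.log (1 / P.beta τ i)⌉₊

/-- The inexact primal update in step `k ≥ 1`: at a labeled node `i`, the map `Φ⁽ⁱ⁾` is applied
`⌈2 log k / log (1/β_i)⌉` times to `w̄⁽ⁱ⁾`; at an unlabeled node, where the empirical risk does
not depend on `w⁽ⁱ⁾`, the exact update `w̄⁽ⁱ⁾` is kept. -/
def inexactPrimalStep (τ : Fin N → ℝ) (k : ℕ) (w : EuclideanSpace ℝ (Fin N × Fin d))
    (u : EuclideanSpace ℝ (G.edgeSet × Fin d)) : EuclideanSpace ℝ (Fin N × Fin d) :=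
  WithLp.toLp 2 fun ia =>
    (if ia.1 ∈ P.train then
      (P.Phi τ ia.1 (block (P.wbar τ w u) ia.1))^[P.innerSteps τ ia.1 k]
        (block (P.wbar τ w u) ia.1)
    else block (P.wbar τ w u) ia.1) ia.2

/-- The pairs `(w_k, u_k)`, `k = 1, 2, …`, are iterates of the inexact primal-dual method. The
pair `(w_1, u_1)` is arbitrary (and the values with index `0` are not used). -/
def IsInexactRun (S : Matrix (G.edgeSet × Fin d) (G.edgeSet × Fin d) ℝ) (τ : Fin N → ℝ)
    (w : ℕ → EuclideanSpace ℝ (Fin N × Fin d)) (u : ℕ → EuclideanSpace ℝ (G.edgeSet × Fin d)) :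
    Prop :=
  ∀ k : ℕ, 1 ≤ k →
    w (k + 1) = P.inexactPrimalStep τ k (w k) (u k) ∧
    u (k + 1) ∈ proxResolvent S (convexConjugate P.g)
      (u k + matVec S (matVec P.D ((2 : ℝ) • w (k + 1) - w k)))

end LnLasso

end

/-!
The primal-dual step is a proximal point step. Write `x = (w, u)` and let `b` be the bilinear form
`b(x, x') = ⟪T⁻¹ w, w'⟫ + ⟪S⁻¹ u, u'⟫ - ⟪u, D w'⟫ - ⟪u', D w⟫` (`primalDualForm`). In the
coordinates `T^{-1/2} w` and `S^{-1/2} u`, the condition `‖S^{1/2} D T^{1/2}‖ < 1` makes `b`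
coercive (`exists_coercive_of_precondNorm_lt_one`). If `x⁺` is the exact update of `x`, its
optimality conditions and those of a saddle point `x̂` add up to `b(x - x⁺, x⁺ - x̂) ≥ 0`, by
monotonicity of subdifferentials, and this is the Fejér inequality
`b(x⁺ - x̂, x⁺ - x̂) + b(x - x⁺, x - x⁺) ≤ b(x - x̂, x - x̂)` (`primalDual_fejer`).

The inexact update differs from the exact one by a summable error. The exact primal update is, on
each labeled node, the fixed point of the `β`-contraction `Φ`, and the number of inner iterations
makes `β ^ n ≤ 1 / k ^ 2` (`exists_exact_primal_update`); the dual resolvent is the projection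
onto the compact convex domain of `g*` in the metric of `S⁻¹`, hence Lipschitz, so the primal
error carries over to the dual variable. A sequence that satisfies the Fejér inequality up to
summable errors has convergent distances to all solutions, its steps tend to zero, and its cluster
points are solutions; so it converges (`exists_tendsto_of_quasiFejer`,
`exists_tendsto_primalDual`).

This argument needs at least one saddle point. Since the domain of `g*` is compact, the minimax
theorem provides a dual optimal point for any given minimizer of the objective
(`exists_multiplier`, `LnLasso.saddleSet_nonempty`). Conversely, as `g(D w)` is the maximum of
`⟪u, D w⟫` over the domain of `g*`, the primal part of a saddle point is a minimizer.
-/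

noncomputable section

open scoped Matrix
open Filter Topology

/-! ### Quasi-Fejér monotone sequences -/

lemma exists_tendsto_of_le_add_summable {a δ : ℕ → ℝ} (ha : ∀ k, 0 ≤ a k) (hδ : Summable δ)
    (hδ0 : ∀ k, 0 ≤ δ k) (h : ∀ k, a (k + 1) ≤ a k + δ k) : ∃ l, Tendsto a atTop (𝓝 l) := by
  have hanti : Antitone fun k => a k - ∑ i ∈ Finset.range k, δ i :=
    antitone_nat_of_succ_le fun k => by
      rw [Finset.sum_range_succ]; linarith [h k]
  have hbdd : BddBelow (Set.range fun k => a k - ∑ i ∈ Finset.range k, δ i) := by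
    refine ⟨-∑' i, δ i, ?_⟩
    rintro _ ⟨k, rfl⟩
    have := hδ.sum_le_tsum (Finset.range k) fun i _ => hδ0 i
    simp only
    linarith [ha k]
  have := (tendsto_atTop_ciInf hanti hbdd).add hδ.hasSum.tendsto_sum_nat
  exact ⟨_, by simpa using this⟩

/-- The triangle inequality for the seminorm of a positive semidefinite bilinear form. -/
lemma sqrt_bilin_add_le {E : Type*} [AddCommGroup E] [Module ℝ E] (b : LinearMap.BilinForm ℝ E)
    (hsymm : ∀ x y, b x y = b y x) (hpos : ∀ x, 0 ≤ b x x) (x y : E) :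
    √(b (x + y) (x + y)) ≤ √(b x x) + √(b y y) := by
  have hcs : b x y ≤ √(b x x) * √(b y y) := by
    rw [← Real.sqrt_mul (hpos x)]
    apply Real.le_sqrt_of_sq_le
    have := b.apply_mul_apply_le_of_forall_zero_le hpos x y
    rwa [← hsymm x y, ← sq] at this
  apply Real.sqrt_le_iff.2 ⟨by positivity, ?_⟩
  have h1 := Real.sq_sqrt (hpos x)
  have h2 := Real.sq_sqrt (hpos y)
  simp only [map_add, LinearMap.add_apply]
  nlinarith [hsymm x y]

/-- Convergence of an inexact proximal-type iteration in the geometry of the form `b`: the points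
`p k` satisfy the Fejér inequality of a firmly nonexpansive step from `z k` with respect to every
solution, and `z (k + 1)` differs from `p k` by a summable error. -/
theorem exists_tendsto_of_quasiFejer {E : Type*} [NormedAddCommGroup E] [NormedSpace ℝ E]
    [FiniteDimensional ℝ E] (b : LinearMap.BilinForm ℝ E) (hsymm : ∀ x y, b x y = b y x)
    {c : ℝ} (hc : 0 < c) (hlow : ∀ x, c * ‖x‖ ^ 2 ≤ b x x)
    {Z : Set E} (hZ : Z.Nonempty) {z p : ℕ → E}
    (hfejer : ∀ k, ∀ x ∈ Z, b (p k - x) (p k - x) + b (z k - p k) (z k - p k) ≤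
      b (z k - x) (z k - x))
    {ε : ℕ → ℝ} (hε : Summable ε) (herr : ∀ k, ‖z (k + 1) - p k‖ ≤ ε k)
    (hcl : ∀ (x : E) (φ : ℕ → ℕ), Tendsto (z ∘ φ) atTop (𝓝 x) →
      Tendsto (p ∘ φ) atTop (𝓝 x) → x ∈ Z) :
    ∃ x ∈ Z, Tendsto z atTop (𝓝 x) := by
  have hproper : ProperSpace E := FiniteDimensional.proper_real E
  have hpos : ∀ x, 0 ≤ b x x := fun x => le_trans (by positivity) (hlow x)
  obtain ⟨K, hK0, hK⟩ : ∃ K : ℝ, 0 ≤ K ∧ ∀ x, √(b x x) ≤ K * ‖x‖ := by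
    refine ⟨√‖b.toContinuousBilinearMap‖, by positivity, fun x => ?_⟩
    apply Real.sqrt_le_iff.2 ⟨by positivity, ?_⟩
    rw [mul_pow, Real.sq_sqrt (norm_nonneg b.toContinuousBilinearMap), sq, ← mul_assoc]
    exact (le_abs_self _).trans (b.toContinuousBilinearMap.le_opNorm₂ x x)
  have hnorm : ∀ x, √c * ‖x‖ ≤ √(b x x) := fun x => by
    apply Real.le_sqrt_of_sq_le
    rw [mul_pow, Real.sq_sqrt hc.le]
    exact hlow x
  have hc' : 0 < √c := Real.sqrt_pos.2 hc
  have hε0 : ∀ k, 0 ≤ ε k := fun k => (norm_nonneg _).trans (herr k)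
  have hKε : Summable fun k => K * ε k := hε.mul_left K
  -- the step from the exact point `p k` to `z (k + 1)`
  have hstep : ∀ k x, √(b (z (k + 1) - x) (z (k + 1) - x)) ≤
      √(b (p k - x) (p k - x)) + K * ε k := fun k x => by
    have h1 := sqrt_bilin_add_le b hsymm hpos (z (k + 1) - p k) (p k - x)
    rw [sub_add_sub_cancel] at h1
    have h2 := (hK (z (k + 1) - p k)).trans (mul_le_mul_of_nonneg_left (herr k) hK0)
    linarith
  have hfe : ∀ k, ∀ x ∈ Z, √(b (p k - x) (p k - x)) ≤ √(b (z k - x) (z k - x)) := fun k x hx =>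
    Real.sqrt_le_sqrt (by linarith [hfejer k x hx, hpos (z k - p k)])
  have hlim : ∀ x ∈ Z, ∃ l, Tendsto (fun k => √(b (z k - x) (z k - x))) atTop (𝓝 l) :=
    fun x hx => exists_tendsto_of_le_add_summable (fun _ => Real.sqrt_nonneg _) hKε
      (fun k => mul_nonneg hK0 (hε0 k)) fun k => (hstep k x).trans (by linarith [hfe k x hx])
  obtain ⟨x₀, hx₀⟩ := hZ
  obtain ⟨l, hl⟩ := hlim x₀ hx₀
  -- both distances in the Fejér inequality have the same limit, so `z k - p k` tends to zero
  have hlp : Tendsto (fun k => √(b (p k - x₀) (p k - x₀))) atTop (𝓝 l) := by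
    have h1 := ((tendsto_add_atTop_iff_nat 1).2 hl).sub hKε.tendsto_atTop_zero
    rw [sub_zero] at h1
    exact tendsto_of_tendsto_of_tendsto_of_le_of_le h1 hl
      (fun k => by simpa using hstep k x₀) fun k => hfe k x₀ hx₀
  have hzp : Tendsto (fun k => z k - p k) atTop (𝓝 0) := by
    have h1 := (hl.pow 2).sub (hlp.pow 2)
    rw [sub_self] at h1
    have h2 : Tendsto (fun k => c * ‖z k - p k‖ ^ 2) atTop (𝓝 0) := by
      refine squeeze_zero (fun k => by positivity) (fun k => ?_) h1
      rw [Real.sq_sqrt (hpos _), Real.sq_sqrt (hpos _)]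
      linarith [hfejer k x₀ hx₀, hlow (z k - p k)]
    have h3 : Tendsto (fun k => ‖z k - p k‖ ^ 2) atTop (𝓝 0) := by
      simpa [← mul_assoc, inv_mul_cancel₀ hc.ne'] using h2.const_mul c⁻¹
    have h4 := h3.sqrt
    simp only [Real.sqrt_sq (norm_nonneg _), Real.sqrt_zero] at h4
    exact tendsto_zero_iff_norm_tendsto_zero.2 h4
  -- a cluster point exists by boundedness
  obtain ⟨R, hR⟩ := hl.bddAbove_range
  have hmem : ∀ k, z k ∈ Metric.closedBall x₀ (R / √c) := fun k => by
    rw [mem_closedBall_iff_norm, le_div_iff₀ hc', mul_comm]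
    exact (hnorm _).trans (hR ⟨k, rfl⟩)
  obtain ⟨x, -, φ, hφ, hx⟩ := (isCompact_closedBall x₀ (R / √c)).tendsto_subseq hmem
  have hxp : Tendsto (p ∘ φ) atTop (𝓝 x) := by
    have := hx.sub (hzp.comp hφ.tendsto_atTop)
    simpa [Function.comp_def] using this
  have hxZ := hcl x φ hx hxp
  refine ⟨x, hxZ, ?_⟩
  -- the distance to the cluster point converges, and a subsequence of it tends to zero
  obtain ⟨m, hm⟩ := hlim x hxZ
  have hm0 : m = 0 := by
    refine tendsto_nhds_unique (hm.comp hφ.tendsto_atTop) ?_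
    have h0 : Tendsto (fun k => ‖z (φ k) - x‖) atTop (𝓝 0) :=
      tendsto_iff_norm_sub_tendsto_zero.1 hx
    have h1 := h0.const_mul K
    rw [mul_zero] at h1
    exact squeeze_zero (fun _ => Real.sqrt_nonneg _) (fun k => hK _) h1
  rw [hm0] at hm
  have h1 := hm.const_mul (√c)⁻¹
  rw [mul_zero] at h1
  refine tendsto_iff_norm_sub_tendsto_zero.2 (squeeze_zero (fun _ => norm_nonneg _)
    (fun k => ?_) h1)
  rw [inv_mul_eq_div, le_div_iff₀ hc', mul_comm]
  exact hnorm _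

/-! ### Convex duality over a compact convex set -/

lemma convexOn_of_subgradient {W : Type*} [NormedAddCommGroup W] [InnerProductSpace ℝ W]
    {h : W → ℝ} (hsub : ∀ w, ∃ q : W, ∀ w', h w + inner ℝ q (w' - w) ≤ h w') :
    ConvexOn ℝ Set.univ h := by
  refine ⟨convex_univ, fun x _ y _ s t hs ht hst => ?_⟩
  obtain ⟨q, hq⟩ := hsub (s • x + t • y)
  have h1 := mul_le_mul_of_nonneg_left (hq x) hs
  have h2 := mul_le_mul_of_nonneg_left (hq y) ht
  have h3 : s * inner ℝ q (x - (s • x + t • y)) + t * inner ℝ q (y - (s • x + t • y)) = 0 := by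
    rw [← real_inner_smul_right, ← real_inner_smul_right, ← inner_add_right]
    convert inner_zero_right q using 2
    obtain rfl : t = 1 - s := by linarith
    module
  have h4 : s * h (s • x + t • y) + t * h (s • x + t • y) = h (s • x + t • y) := by
    rw [← add_mul, hst, one_mul]
  simp only [smul_eq_mul]
  linarith

/-- The proximal step is solvable: a symmetric linear variational inequality
over a compact set has a solution, the minimizer of the associated quadratic function. -/
lemma exists_variational_solution {U : Type*} [NormedAddCommGroup U] [InnerProductSpace ℝ U]
    {C : Set U} (hC : IsCompact C) (hconv : Convex ℝ C) (hne : C.Nonempty) (Q : U →L[ℝ] U)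
    (hQ : ∀ x y, inner ℝ (Q x) y = inner ℝ x (Q y)) (r : U) :
    ∃ v ∈ C, ∀ c ∈ C, inner ℝ (r - Q v) (c - v) ≤ 0 := by
  obtain ⟨v, hv, hmin⟩ := hC.exists_isMinOn hne
    (f := fun x => inner ℝ (Q x) x - 2 * inner ℝ r x) (by fun_prop)
  refine ⟨v, hv, fun c hc => ?_⟩
  -- compare `v` with the points `v + t (c - v)` for `t ↓ 0`
  have key : ∀ t : ℝ, 0 < t → t ≤ 1 →
      0 ≤ -2 * inner ℝ (r - Q v) (c - v) + t * inner ℝ (Q (c - v)) (c - v) := fun t ht ht1 => by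
    have h1 : v + t • (c - v) ∈ C := hconv.add_smul_sub_mem hv hc ⟨ht.le, ht1⟩
    have h2 := hmin h1
    simp only [Set.mem_ofPred_eq, map_add, map_smul, inner_add_left, inner_add_right,
      inner_smul_left, inner_smul_right, RCLike.conj_to_real] at h2
    rw [hQ (c - v) v, real_inner_comm (Q v) (c - v)] at h2
    rw [inner_sub_left]
    have h3 : 0 ≤ t * (-2 * (inner ℝ r (c - v) - inner ℝ (Q v) (c - v)) +
        t * inner ℝ (Q (c - v)) (c - v)) := by linarith
    exact nonneg_of_mul_nonneg_right h3 ht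
  by_contra! hcon
  set α : ℝ := inner ℝ (r - Q v) (c - v)
  set β : ℝ := inner ℝ (Q (c - v)) (c - v)
  have hβ : 0 < |β| + α := by positivity
  have h1 := key (α / (|β| + α)) (by positivity) (by rw [div_le_one hβ]; linarith [abs_nonneg β])
  have h2 : α / (|β| + α) * β ≤ α := by
    rw [div_mul_eq_mul_div, div_le_iff₀ hβ]
    nlinarith [le_abs_self β]
  linarith

/-- Existence of a Lagrange multiplier, a consequence of the minimax theorem: only the dual set has
to be compact. -/
lemma exists_multiplier {W U : Type*} [NormedAddCommGroup W] [InnerProductSpace ℝ W]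
    [NormedAddCommGroup U] [InnerProductSpace ℝ U] {C : Set U} (hC : IsCompact C)
    (hconv : Convex ℝ C) (hne : C.Nonempty) {h : W → ℝ} (hh : ConvexOn ℝ Set.univ h)
    (hcont : Continuous h) (D : W →L[ℝ] U) {m : ℝ}
    (hm : ∀ w, ∃ c ∈ C, m ≤ h w + inner ℝ c (D w)) :
    ∃ u ∈ C, ∀ w, m ≤ h w + inner ℝ u (D w) := by
  by_contra! hcon
  -- by compactness, finitely many `w` witness the failure for all `u ∈ C`
  obtain ⟨s, hs⟩ : ∃ s : Finset W, C ⊆ ⋃ w ∈ s, {u | h w + inner ℝ u (D w) < m} :=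
    hC.elim_finite_subcover _
      (fun w => isOpen_lt (by fun_prop) continuous_const) fun u hu => by
        simpa using hcon u hu
  obtain ⟨w, -, hw⟩ := Sion.exists_lt_iInf_of_lt_iInf_of_finite (X := C) (Y := Set.univ)
    (f := fun u w => -(h w + inner ℝ u (D w))) (t := -m) hne hC
    (fun w _ => (show Continuous _ by fun_prop).lowerSemicontinuous.lowerSemicontinuousOn _)
    (fun w _ => ConvexOn.quasiconvexOn (by
      refine ⟨hconv, fun x _ y _ a b _ _ hab => le_of_eq ?_⟩
      simp only [inner_add_left, inner_smul_left, RCLike.conj_to_real, smul_eq_mul]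
      linear_combination h w * hab))
    convex_univ
    (fun u _ => (show Continuous _ by fun_prop).upperSemicontinuous.upperSemicontinuousOn _)
    (fun u _ => ConcaveOn.quasiconcaveOn (by
      refine ConvexOn.neg (hh.add ?_)
      refine ⟨convex_univ, fun x _ y _ a b _ _ hab => le_of_eq ?_⟩
      simp only [map_add, map_smul, inner_add_right, inner_smul_right, smul_eq_mul]))
    hconv s.finite_toSet (Set.subset_univ _) (fun u hu => by
      have := hs hu
      simpa using this)
  obtain ⟨c, hc, hmc⟩ := hm w
  linarith [hw c hc]

/-! ### The inexact primal-dual method -/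

section PrimalDual

variable {W U : Type*} [NormedAddCommGroup W] [InnerProductSpace ℝ W]
  [NormedAddCommGroup U] [InnerProductSpace ℝ U]

/-- The set of saddle points of `⟪u, D w⟫ + h w` over `w ∈ W` and `u ∈ C`. As the function is linear
in `u`, the maximality of `u` is stated as a variational inequality. -/
def saddleSet (C : Set U) (h : W → ℝ) (D : W →L[ℝ] U) : Set (W × U) :=
  {x | x.2 ∈ C ∧ (∀ c ∈ C, inner ℝ (D x.1) (c - x.2) ≤ 0) ∧
    ∀ w, h x.1 + inner ℝ x.2 (D x.1) ≤ h w + inner ℝ x.2 (D w)}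

/-- The form `⟪T⁻¹ w, w'⟫ + ⟪S⁻¹ u, u'⟫ - ⟪u, D w'⟫ - ⟪u', D w⟫` whose geometry makes the
primal-dual step a proximal point step; `Ti` and `Si` stand for `T⁻¹` and `S⁻¹`. -/
def primalDualForm (Ti : W →L[ℝ] W) (Si : U →L[ℝ] U) (D : W →L[ℝ] U) :
    LinearMap.BilinForm ℝ (W × U) :=
  LinearMap.mk₂ ℝ (fun x y => inner ℝ (Ti x.1) y.1 + inner ℝ (Si x.2) y.2
      - inner ℝ x.2 (D y.1) - inner ℝ y.2 (D x.1))
    (fun x y z => by simp only [Prod.fst_add, Prod.snd_add, map_add, inner_add_left,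
      inner_add_right]; ring)
    (fun a x y => by simp only [Prod.smul_fst, Prod.smul_snd, map_smul, real_inner_smul_left,
      real_inner_smul_right, smul_eq_mul]; ring)
    (fun x y z => by simp only [Prod.fst_add, Prod.snd_add, map_add, inner_add_left,
      inner_add_right]; ring)
    (fun a x y => by simp only [Prod.smul_fst, Prod.smul_snd, map_smul, real_inner_smul_left,
      real_inner_smul_right, smul_eq_mul]; ring)

lemma primalDualForm_apply (Ti : W →L[ℝ] W) (Si : U →L[ℝ] U) (D : W →L[ℝ] U) (x y : W × U) :
    primalDualForm Ti Si D x y = inner ℝ (Ti x.1) y.1 + inner ℝ (Si x.2) y.2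
      - inner ℝ x.2 (D y.1) - inner ℝ y.2 (D x.1) := rfl

lemma primalDualForm_symm {Ti : W →L[ℝ] W} {Si : U →L[ℝ] U} (D : W →L[ℝ] U)
    (hTi : ∀ x y, inner ℝ (Ti x) y = inner ℝ x (Ti y))
    (hSi : ∀ x y, inner ℝ (Si x) y = inner ℝ x (Si y)) (x y : W × U) :
    primalDualForm Ti Si D x y = primalDualForm Ti Si D y x := by
  rw [primalDualForm_apply, primalDualForm_apply, hTi, hSi, real_inner_comm x.1,
    real_inner_comm x.2 (Si y.2)]
  ring

/-- The exact primal-dual step from `(w, u)` to `(p, v)` satisfies the Fejér inequality: its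
optimality conditions say that the step is a proximal point step in the form `primalDualForm`. -/
lemma primalDual_fejer {Ti : W →L[ℝ] W} {Si : U →L[ℝ] U} {D : W →L[ℝ] U} {Dt : U →L[ℝ] W}
    (hTi : ∀ x y, inner ℝ (Ti x) y = inner ℝ x (Ti y))
    (hSi : ∀ x y, inner ℝ (Si x) y = inner ℝ x (Si y))
    (hDt : ∀ u w, inner ℝ (Dt u) w = inner ℝ u (D w))
    {C : Set U} {h : W → ℝ} {w p : W} {u v : U} (hv : v ∈ C)
    (hp : ∀ w', h p + inner ℝ (Ti (w - p) - Dt u) (w' - p) ≤ h w')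
    (hd : ∀ c ∈ C, inner ℝ (Si (u - v) + D ((2 : ℝ) • p - w)) (c - v) ≤ 0)
    {x : W × U} (hx : x ∈ saddleSet C h D) :
    primalDualForm Ti Si D ((p, v) - x) ((p, v) - x) +
        primalDualForm Ti Si D ((w, u) - (p, v)) ((w, u) - (p, v)) ≤
      primalDualForm Ti Si D ((w, u) - x) ((w, u) - x) := by
  obtain ⟨hxC, hx1, hx2⟩ := hx
  have hcross : 0 ≤ primalDualForm Ti Si D ((w, u) - (p, v)) ((p, v) - x) := by
    have h1 := hp x.1
    have h2 := hx2 p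
    have h3 := hd x.2 hxC
    have h4 := hx1 v hv
    rw [primalDualForm_apply]
    simp only [Prod.fst_sub, Prod.snd_sub, map_sub, map_smul, inner_sub_left, inner_sub_right,
      inner_add_left, real_inner_smul_left, hDt] at h1 h2 h3 h4 ⊢
    simp only [real_inner_comm (D _)] at h1 h2 h3 h4 ⊢
    linarith
  have hsum : (w, u) - x = ((w, u) - (p, v)) + ((p, v) - x) := by abel
  rw [hsum]
  simp only [map_add, LinearMap.add_apply]
  have := primalDualForm_symm D hTi hSi ((p, v) - x) ((w, u) - (p, v))
  linarith

/-- Convergence of the primal-dual method with summable errors `δ k` in the primal step. The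
points `p k` are the exact primal updates. -/
theorem exists_tendsto_primalDual [FiniteDimensional ℝ W] [FiniteDimensional ℝ U]
    {Ti : W →L[ℝ] W} {Si : U →L[ℝ] U} {D : W →L[ℝ] U} {Dt : U →L[ℝ] W}
    (hTi : ∀ x y, inner ℝ (Ti x) y = inner ℝ x (Ti y))
    (hSi : ∀ x y, inner ℝ (Si x) y = inner ℝ x (Si y))
    (hDt : ∀ u w, inner ℝ (Dt u) w = inner ℝ u (D w))
    {c : ℝ} (hc : 0 < c)
    (hlow : ∀ w u, c * (‖w‖ ^ 2 + ‖u‖ ^ 2) ≤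
      inner ℝ (Ti w) w + inner ℝ (Si u) u - 2 * inner ℝ u (D w))
    {C : Set U} (hC : IsCompact C) (hconv : Convex ℝ C) {h : W → ℝ} (hcont : Continuous h)
    (hZ : (saddleSet C h D).Nonempty) {w p : ℕ → W} {u : ℕ → U} {δ : ℕ → ℝ} (hδ : Summable δ)
    (hp : ∀ k w', h (p k) + inner ℝ (Ti (w k - p k) - Dt (u k)) (w' - p k) ≤ h w')
    (herr : ∀ k, ‖w (k + 1) - p k‖ ≤ δ k) (huC : ∀ k, u (k + 1) ∈ C)
    (hd : ∀ k, ∀ c ∈ C,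
      inner ℝ (Si (u k - u (k + 1)) + D ((2 : ℝ) • w (k + 1) - w k)) (c - u (k + 1)) ≤ 0) :
    ∃ x ∈ saddleSet C h D, Tendsto w atTop (𝓝 x.1) ∧ Tendsto u atTop (𝓝 x.2) := by
  -- the exact dual updates
  have hv : ∀ k, ∃ v ∈ C, ∀ c ∈ C,
      inner ℝ (Si (u k - v) + D ((2 : ℝ) • p k - w k)) (c - v) ≤ 0 := fun k => by
    obtain ⟨v, hv, h1⟩ := exists_variational_solution hC hconv ⟨_, huC 0⟩ Si hSi
      (Si (u k) + D ((2 : ℝ) • p k - w k))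
    refine ⟨v, hv, fun c hc => ?_⟩
    convert h1 c hc using 2
    rw [map_sub]
    abel
  choose v hvC hvd using hv
  have hSlow : ∀ x : U, c * ‖x‖ ^ 2 ≤ inner ℝ (Si x) x := fun x => by
    simpa using hlow 0 x
  -- the dual resolvent is Lipschitz
  have hdual : ∀ k, ‖u (k + 1) - v k‖ ≤ 2 * ‖D‖ / c * δ k := fun k => by
    have h1 := hd k (v k) (hvC k)
    have h2 := hvd k (u (k + 1)) (huC k)
    have h3 := hSlow (u (k + 1) - v k)
    have h4 : inner ℝ (Si (u (k + 1) - v k)) (u (k + 1) - v k) ≤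
        2 * inner ℝ (D (w (k + 1) - p k)) (u (k + 1) - v k) := by
      simp only [map_sub, map_smul, inner_sub_left, inner_sub_right,
        inner_add_left, real_inner_smul_left] at h1 h2 ⊢
      linarith
    have h5 : inner ℝ (D (w (k + 1) - p k)) (u (k + 1) - v k) ≤
        ‖D‖ * δ k * ‖u (k + 1) - v k‖ :=
      (real_inner_le_norm _ _).trans (mul_le_mul_of_nonneg_right
        ((D.le_opNorm _).trans (mul_le_mul_of_nonneg_left (herr k) (norm_nonneg _)))
        (norm_nonneg _))
    have hδ0 : 0 ≤ δ k := (norm_nonneg _).trans (herr k)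
    rw [div_mul_eq_mul_div, le_div_iff₀ hc]
    rcases (norm_nonneg (u (k + 1) - v k)).eq_or_lt with h0 | h0
    · rw [← h0, zero_mul]; positivity
    · refine le_of_mul_le_mul_right ?_ h0
      nlinarith
  have hmain := exists_tendsto_of_quasiFejer (primalDualForm Ti Si D)
    (primalDualForm_symm D hTi hSi) hc (fun x => ?_) hZ (z := fun k => (w k, u k))
    (p := fun k => (p k, v k))
    (fun k x hx => primalDual_fejer hTi hSi hDt (hvC k) (hp k) (hvd k) hx)
    (ε := fun k => δ k + 2 * ‖D‖ / c * δ k) (hδ.add (hδ.mul_left _)) (fun k => ?_) ?_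
  · obtain ⟨x, hx, hlim⟩ := hmain
    exact ⟨x, hx, (continuous_fst.tendsto _).comp hlim, (continuous_snd.tendsto _).comp hlim⟩
  · rw [primalDualForm_apply]
    have h1 : ‖x‖ ^ 2 ≤ ‖x.1‖ ^ 2 + ‖x.2‖ ^ 2 := by
      rcases max_choice ‖x.1‖ ‖x.2‖ with h | h <;> rw [Prod.norm_def, h] <;>
        nlinarith [sq_nonneg ‖x.1‖, sq_nonneg ‖x.2‖]
    nlinarith [hlow x.1 x.2]
  · have h1 := norm_fst_le ((w (k + 1), u (k + 1)) - (p k, v k))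
    simp only [Prod.mk_sub_mk, Prod.norm_mk]
    have hδ0 : 0 ≤ δ k := (norm_nonneg _).trans (herr k)
    have h2 : 0 ≤ 2 * ‖D‖ / c * δ k := by positivity
    exact max_le (by linarith [herr k]) (by linarith [hdual k])
  · -- cluster points satisfy the optimality conditions, by continuity
    intro x φ hz hzp
    have hw : Tendsto (fun k => w (φ k)) atTop (𝓝 x.1) := (continuous_fst.tendsto _).comp hz
    have hu : Tendsto (fun k => u (φ k)) atTop (𝓝 x.2) := (continuous_snd.tendsto _).comp hz
    have hpp : Tendsto (fun k => p (φ k)) atTop (𝓝 x.1) := (continuous_fst.tendsto _).comp hzp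
    have hvv : Tendsto (fun k => v (φ k)) atTop (𝓝 x.2) := (continuous_snd.tendsto _).comp hzp
    refine ⟨hC.isClosed.mem_of_tendsto hvv (Eventually.of_forall fun k => hvC _), ?_, ?_⟩
    · intro c hc
      have h1 : Tendsto (fun k => inner ℝ (Si (u (φ k) - v (φ k)) +
          D ((2 : ℝ) • p (φ k) - w (φ k))) (c - v (φ k))) atTop
          (𝓝 (inner ℝ (Si (x.2 - x.2) + D ((2 : ℝ) • x.1 - x.1)) (c - x.2))) :=
        (((Si.continuous.tendsto _).comp (hu.sub hvv)).add
          ((D.continuous.tendsto _).comp ((hpp.const_smul (2 : ℝ)).sub hw))).inner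
          (tendsto_const_nhds.sub hvv)
      have h2 := le_of_tendsto h1 (Eventually.of_forall fun k => hvd (φ k) c hc)
      rwa [sub_self, map_zero, zero_add, two_smul, add_sub_cancel_right] at h2
    · intro w'
      have h1 : Tendsto (fun k => h (p (φ k)) +
          inner ℝ (Ti (w (φ k) - p (φ k)) - Dt (u (φ k))) (w' - p (φ k))) atTop
          (𝓝 (h x.1 + inner ℝ (Ti (x.1 - x.1) - Dt x.2) (w' - x.1))) :=
        ((hcont.tendsto _).comp hpp).add
          ((((Ti.continuous.tendsto _).comp (hw.sub hpp)).sub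
            ((Dt.continuous.tendsto _).comp hu)).inner (tendsto_const_nhds.sub hpp))
      have h2 := le_of_tendsto h1 (Eventually.of_forall fun k => hp (φ k) w')
      rw [sub_self, map_zero, zero_sub, inner_neg_left, hDt, map_sub, inner_sub_right] at h2
      linarith

end PrimalDual

/-! ### Matrices acting on Euclidean space -/

section MatVec

variable {ι κ : Type*} [Fintype ι] [Fintype κ]

/-- The continuous linear map `v ↦ B v`. -/
def matCLM [DecidableEq κ] (B : Matrix ι κ ℝ) : EuclideanSpace ℝ κ →L[ℝ] EuclideanSpace ℝ ι :=
  LinearMap.toContinuousLinearMap (Matrix.toEuclideanLin B)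

lemma matCLM_apply [DecidableEq κ] (B : Matrix ι κ ℝ) (v : EuclideanSpace ℝ κ) :
    matCLM B v = matVec B v := rfl

lemma matVec_mul {α β γ : Type*} [Fintype β] [Fintype γ] (A : Matrix α β ℝ) (B : Matrix β γ ℝ)
    (v : EuclideanSpace ℝ γ) :
    matVec (A * B) v = matVec A (matVec B v) := by
  simp [matVec, Matrix.mulVec_mulVec]

lemma matVec_one [DecidableEq ι] (v : EuclideanSpace ℝ ι) :
    matVec (1 : Matrix ι ι ℝ) v = v := by
  simp [matVec]

lemma inner_matVec_transpose (B : Matrix ι κ ℝ) (u : EuclideanSpace ℝ ι)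
    (v : EuclideanSpace ℝ κ) : inner ℝ (matVec Bᵀ u) v = inner ℝ u (matVec B v) := by
  simp only [matVec, EuclideanSpace.inner_eq_star_dotProduct, star_trivial]
  rw [Matrix.mulVec_transpose, dotProduct_comm, ← Matrix.dotProduct_mulVec, dotProduct_comm]

lemma posDef_inner_pos {S : Matrix ι ι ℝ} (hS : S.PosDef) {v : EuclideanSpace ℝ ι} (hv : v ≠ 0) :
    0 < inner ℝ (matVec S v) v := by
  have h := hS.dotProduct_mulVec_pos (x := v.ofLp) (by simpa using hv)
  simpa [matVec, EuclideanSpace.inner_eq_star_dotProduct] using h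

lemma matVec_inv_cancel_left [DecidableEq ι] {S : Matrix ι ι ℝ} (hS : IsUnit S.det)
    (v : EuclideanSpace ℝ ι) : matVec S⁻¹ (matVec S v) = v := by
  rw [← matVec_mul, Matrix.nonsing_inv_mul _ hS, matVec_one]

lemma matVec_inv_cancel_right [DecidableEq ι] {S : Matrix ι ι ℝ} (hS : IsUnit S.det)
    (v : EuclideanSpace ℝ ι) : matVec S (matVec S⁻¹ v) = v := by
  rw [← matVec_mul, Matrix.mul_nonsing_inv _ hS, matVec_one]

lemma posDef_isUnit_det [DecidableEq ι] {S : Matrix ι ι ℝ} (hS : S.PosDef) : IsUnit S.det :=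
  hS.det_pos.ne'.isUnit

lemma inner_matVec_posDef_inv [DecidableEq ι] {S : Matrix ι ι ℝ} (hS : S.PosDef)
    (u v : EuclideanSpace ℝ ι) : inner ℝ (matVec S⁻¹ u) v = inner ℝ u (matVec S⁻¹ v) := by
  have h : (S⁻¹)ᵀ = S⁻¹ := by simpa using hS.inv.isHermitian.eq
  rw [← inner_matVec_transpose, h]

open scoped MatrixOrder Matrix.Norms.L2Operator in
lemma posDef_sqrt [DecidableEq ι] {S : Matrix ι ι ℝ} (hS : S.PosDef) :
    CFC.sqrt S * CFC.sqrt S = S ∧ (CFC.sqrt S)ᵀ = CFC.sqrt S := by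
  refine ⟨CFC.sqrt_mul_sqrt_self S hS.posSemidef.nonneg, ?_⟩
  have := (Matrix.nonneg_iff_posSemidef.1 (CFC.sqrt_nonneg S)).isHermitian.eq
  simpa using this

open scoped MatrixOrder Matrix.Norms.L2Operator in
/-- In the coordinates `S^{-1/2} u`, the form of `S⁻¹` is the square of the Euclidean norm. -/
lemma exists_sqrt_coordinates [DecidableEq ι] {S : Matrix ι ι ℝ} (hS : S.PosDef)
    (u : EuclideanSpace ℝ ι) : ∃ a, u = matVec (CFC.sqrt S) a ∧
      inner ℝ (matVec S⁻¹ u) u = ‖a‖ ^ 2 := by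
  obtain ⟨hmul, htr⟩ := posDef_sqrt hS
  set R := CFC.sqrt S
  have hR : IsUnit R.det := by
    have h := posDef_isUnit_det hS
    rw [← hmul, Matrix.det_mul] at h
    exact isUnit_of_mul_isUnit_left h
  refine ⟨matVec R⁻¹ u, (matVec_inv_cancel_right hR u).symm, ?_⟩
  have htr' : (R⁻¹)ᵀ = R⁻¹ := by rw [Matrix.transpose_nonsing_inv, htr]
  rw [← hmul, Matrix.mul_inv_rev, matVec_mul]
  nth_rewrite 1 [← htr']
  rw [inner_matVec_transpose, real_inner_self_eq_norm_sq]

open scoped MatrixOrder Matrix.Norms.L2Operator in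
/-- The step size condition `‖S^{1/2} B T^{1/2}‖ < 1` makes the primal-dual form coercive. -/
lemma exists_coercive_of_precondNorm_lt_one [DecidableEq ι] [DecidableEq κ] {S : Matrix ι ι ℝ}
    {T : Matrix κ κ ℝ} (hS : S.PosDef) (hT : T.PosDef) (B : Matrix ι κ ℝ)
    (h : precondNorm S B T < 1) :
    ∃ c : ℝ, 0 < c ∧ ∀ (w : EuclideanSpace ℝ κ) (u : EuclideanSpace ℝ ι),
      c * (‖w‖ ^ 2 + ‖u‖ ^ 2) ≤
        inner ℝ (matVec T⁻¹ w) w + inner ℝ (matVec S⁻¹ u) u - 2 * inner ℝ u (matVec B w) := by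
  set ρ := precondNorm S B T with hρ
  -- `K` bounds the norms of `S^{1/2}` and `T^{1/2}`, and the `1` makes it positive
  set K := ‖matCLM (CFC.sqrt S)‖ + ‖matCLM (CFC.sqrt T)‖ + 1 with hK
  have hK1 : 0 < K := by positivity
  have hρ0 : 0 ≤ ρ := norm_nonneg _
  have hK2 : 0 < (1 - ρ) / K ^ 2 := div_pos (by linarith) (by positivity)
  refine ⟨(1 - ρ) / K ^ 2, hK2, fun w u => ?_⟩
  obtain ⟨a, hwa, ha⟩ := exists_sqrt_coordinates hT w
  obtain ⟨b, hub, hb⟩ := exists_sqrt_coordinates hS u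
  have hw : ‖w‖ ≤ K * ‖a‖ := by
    rw [hwa, ← matCLM_apply]
    refine (ContinuousLinearMap.le_opNorm _ _).trans (mul_le_mul_of_nonneg_right ?_ (norm_nonneg _))
    linarith [norm_nonneg (matCLM (CFC.sqrt S))]
  have hu : ‖u‖ ≤ K * ‖b‖ := by
    rw [hub, ← matCLM_apply]
    refine (ContinuousLinearMap.le_opNorm _ _).trans (mul_le_mul_of_nonneg_right ?_ (norm_nonneg _))
    linarith [norm_nonneg (matCLM (CFC.sqrt T))]
  have hcross : inner ℝ u (matVec B w) ≤ ρ * ‖a‖ * ‖b‖ := by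
    have h1 : inner ℝ u (matVec B w) =
        inner ℝ b (matVec (CFC.sqrt S * B * CFC.sqrt T) a) := by
      rw [matVec_mul, matVec_mul, ← hwa, ← inner_matVec_transpose (CFC.sqrt S),
        (posDef_sqrt hS).2, ← hub]
    have h2 : ‖matVec (CFC.sqrt S * B * CFC.sqrt T) a‖ ≤ ρ * ‖a‖ :=
      Matrix.l2_opNorm_mulVec (CFC.sqrt S * B * CFC.sqrt T) a
    rw [h1]
    refine (real_inner_le_norm _ _).trans ?_
    rw [mul_comm]
    exact mul_le_mul_of_nonneg_right h2 (norm_nonneg _)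
  have hsq : ‖w‖ ^ 2 + ‖u‖ ^ 2 ≤ K ^ 2 * (‖a‖ ^ 2 + ‖b‖ ^ 2) := by
    have h1 := pow_le_pow_left₀ (norm_nonneg _) hw 2
    have h2 := pow_le_pow_left₀ (norm_nonneg _) hu 2
    rw [mul_pow] at h1 h2
    linarith
  have h3 := mul_le_mul_of_nonneg_left hsq hK2.le
  rw [← mul_assoc, div_mul_cancel₀ _ (by positivity : K ^ 2 ≠ 0)] at h3
  rw [ha, hb]
  nlinarith [mul_nonneg hρ0 (sq_nonneg (‖a‖ - ‖b‖))]

end MatVec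

/-! ### Resolvents -/

lemma mem_subdifferential_coe {ι : Type*} [Fintype ι] {h : EuclideanSpace ℝ ι → ℝ}
    {p q : EuclideanSpace ℝ ι} :
    q ∈ subdifferential (fun z => (h z : EReal)) p ↔ ∀ z, h p + inner ℝ q (z - p) ≤ h z := by
  simp only [subdifferential, Set.mem_ofPred_eq, ← EReal.coe_add, EReal.coe_le_coe_iff]

/-- Resolvents of monotone operators are at most single-valued. -/
lemma proxResolvent_unique {ι : Type*} [Fintype ι] {S : Matrix ι ι ℝ} (hS : S.PosDef)
    {f : EuclideanSpace ℝ ι → EReal}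
    (hmono : ∀ p₁ p₂, ∀ q₁ ∈ subdifferential f p₁, ∀ q₂ ∈ subdifferential f p₂,
      0 ≤ inner ℝ (q₁ - q₂) (p₁ - p₂))
    {v p₁ p₂ : EuclideanSpace ℝ ι} (h₁ : p₁ ∈ proxResolvent S f v)
    (h₂ : p₂ ∈ proxResolvent S f v) : p₁ = p₂ := by
  classical
  obtain ⟨q₁, hq₁, hv₁⟩ := h₁
  obtain ⟨q₂, hq₂, hv₂⟩ := h₂
  have hp : p₁ - p₂ = -matVec S (q₁ - q₂) := by
    have h : p₁ + matVec S q₁ = p₂ + matVec S q₂ := hv₁.symm.trans hv₂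
    rw [← matCLM_apply, map_sub, matCLM_apply, matCLM_apply]
    rw [eq_neg_iff_add_eq_zero, ← sub_eq_zero.2 h]
    abel
  have hm := hmono p₁ p₂ q₁ hq₁ q₂ hq₂
  rw [hp, inner_neg_right, real_inner_comm] at hm
  have hq : q₁ - q₂ = 0 := by
    by_contra hne
    linarith [posDef_inner_pos hS hne]
  rw [hq, ← matCLM_apply, map_zero, neg_zero] at hp
  exact sub_eq_zero.1 hp

lemma subdifferential_coe_monotone {ι : Type*} [Fintype ι] {h : EuclideanSpace ℝ ι → ℝ}
    (p₁ p₂ : EuclideanSpace ℝ ι) :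
    ∀ q₁ ∈ subdifferential (fun z => (h z : EReal)) p₁,
    ∀ q₂ ∈ subdifferential (fun z => (h z : EReal)) p₂, 0 ≤ inner ℝ (q₁ - q₂) (p₁ - p₂) := by
  intro q₁ hq₁ q₂ hq₂
  have h1 := mem_subdifferential_coe.1 hq₁ p₂
  have h2 := mem_subdifferential_coe.1 hq₂ p₁
  rw [← neg_sub p₁ p₂, inner_neg_right] at h1
  rw [inner_sub_left]
  linarith

/-! ### Block vectors -/

section Block

variable {ι : Type*} {d : ℕ}

lemma block_sub (u v : EuclideanSpace ℝ (ι × Fin d)) (i : ι) :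
    block (u - v) i = block u i - block v i := rfl

lemma block_add (u v : EuclideanSpace ℝ (ι × Fin d)) (i : ι) :
    block (u + v) i = block u i + block v i := rfl

lemma block_smul (a : ℝ) (u : EuclideanSpace ℝ (ι × Fin d)) (i : ι) :
    block (a • u) i = a • block u i := rfl

lemma block_zero (i : ι) : block (0 : EuclideanSpace ℝ (ι × Fin d)) i = 0 := rfl

lemma continuous_block (i : ι) :
    Continuous fun u : EuclideanSpace ℝ (ι × Fin d) => block u i := by
  unfold block
  fun_prop

variable [Fintype ι]

lemma inner_eq_sum_block (u v : EuclideanSpace ℝ (ι × Fin d)) :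
    inner ℝ u v = ∑ i, inner ℝ (block u i) (block v i) := by
  simp only [PiLp.inner_apply, Fintype.sum_prod_type]
  rfl

lemma norm_sq_eq_sum_block (u : EuclideanSpace ℝ (ι × Fin d)) :
    ‖u‖ ^ 2 = ∑ i, ‖block u i‖ ^ 2 := by
  simp only [← real_inner_self_eq_norm_sq, inner_eq_sum_block]

lemma norm_le_card_mul_of_block_le {u : EuclideanSpace ℝ (ι × Fin d)} {ε : ℝ} (hε : 0 ≤ ε)
    (h : ∀ i, ‖block u i‖ ≤ ε) : ‖u‖ ≤ Fintype.card ι * ε := by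
  refine le_of_sq_le_sq ?_ (by positivity)
  rw [norm_sq_eq_sum_block]
  calc ∑ i, ‖block u i‖ ^ 2 ≤ ∑ _i : ι, ε ^ 2 :=
        Finset.sum_le_sum fun i _ => pow_le_pow_left₀ (norm_nonneg _) (h i) 2
    _ = Fintype.card ι * ε ^ 2 := by simp
    _ ≤ (Fintype.card ι * ε) ^ 2 := by
        rw [mul_pow]
        refine mul_le_mul_of_nonneg_right ?_ (sq_nonneg ε)
        exact_mod_cast Nat.le_self_pow two_ne_zero _

end Block

/-! ### The logistic loss -/

lemma continuous_logisticLoss : Continuous logisticLoss := by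
  unfold logisticLoss
  exact Continuous.log (by fun_prop) fun z => by positivity

/-- The derivative `-σ(-a)` of the logistic loss is a subgradient. -/
lemma logisticLoss_subgradient (a b : ℝ) :
    logisticLoss a + -Real.sigmoid (-a) * (b - a) ≤ logisticLoss b := by
  -- `exp (s t) ≤ (1 - s) + s exp t` with `s = σ(-a)` and `t = a - b`
  set s := Real.sigmoid (-a) with hs
  have hs0 := Real.sigmoid_nonneg (-a)
  have hs1 := Real.sigmoid_le_one (-a)
  have hconv := convexOn_exp.2 (Set.mem_univ (0 : ℝ)) (Set.mem_univ (a - b))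
    (sub_nonneg.2 hs1) hs0 (by ring)
  simp only [smul_eq_mul, mul_zero, zero_add, Real.exp_zero, mul_one] at hconv
  have ha : 0 < 1 + Real.exp (-a) := by positivity
  have hb : 0 < 1 + Real.exp (-b) := by positivity
  have hsa : s * (1 + Real.exp (-a)) = Real.exp (-a) := by
    rw [hs, Real.sigmoid_def, neg_neg, inv_mul_eq_iff_eq_mul₀ (by positivity), add_mul, one_mul,
      ← Real.exp_add]
    simp [add_comm]
  have hmul : (1 - s + s * Real.exp (a - b)) * (1 + Real.exp (-a)) = 1 + Real.exp (-b) := by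
    have h1 : Real.exp (-a) * Real.exp (a - b) = Real.exp (-b) := by
      rw [← Real.exp_add]; congr 1; ring
    linear_combination (Real.exp (a - b) - 1) * hsa + h1
  have h2 : Real.exp (s * (a - b)) * (1 + Real.exp (-a)) ≤ 1 + Real.exp (-b) := by
    rw [← hmul]
    exact mul_le_mul_of_nonneg_right hconv ha.le
  have h3 := Real.log_le_log (by positivity) h2
  rw [Real.log_mul (Real.exp_pos _).ne' ha.ne', Real.log_exp] at h3
  unfold logisticLoss
  linarith

lemma abs_sigmoid_sub_le (a b : ℝ) : |Real.sigmoid a - Real.sigmoid b| ≤ |a - b| := by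
  have h : LipschitzWith 1 Real.sigmoid := by
    refine lipschitzWith_of_nnnorm_deriv_le differentiable_sigmoid fun x => ?_
    rw [← NNReal.coe_le_coe, coe_nnnorm, Real.deriv_sigmoid, Real.norm_eq_abs, NNReal.coe_one,
      abs_le]
    constructor <;> nlinarith [Real.sigmoid_nonneg x, Real.sigmoid_le_one x]
  simpa [Real.dist_eq] using h.dist_le_mul a b

namespace LnLasso

variable {N d : ℕ} {G : SimpleGraph (Fin N)} (P : LnLasso G d)

lemma M_pos : 0 < P.M := by
  unfold M
  exact_mod_cast P.train_nonempty.card_pos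

variable {P} in
lemma norm_xt {i : Fin N} (hi : i ∈ P.train) : ‖P.xt i‖ = 1 := by
  rcases P.y_eq i hi with h | h <;> simp [xt, h, P.norm_x]

lemma beta_eq (τ : Fin N → ℝ) (i : Fin N) : P.beta τ i = τ i / P.M := by
  simp [beta, P.norm_x]

/-! ### The empirical risk -/

/-- The gradient of the empirical risk. -/
def riskGrad (w : EuclideanSpace ℝ (Fin N × Fin d)) : EuclideanSpace ℝ (Fin N × Fin d) :=
  WithLp.toLp 2 fun ia => (if ia.1 ∈ P.train then
    (-(1 / P.M * Real.sigmoid (-inner ℝ (block w ia.1) (P.xt ia.1)))) • P.xt ia.1 else 0) ia.2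

lemma block_riskGrad (w : EuclideanSpace ℝ (Fin N × Fin d)) (i : Fin N) :
    block (P.riskGrad w) i = if i ∈ P.train then
      (-(1 / P.M * Real.sigmoid (-inner ℝ (block w i) (P.xt i)))) • P.xt i else 0 := rfl

lemma continuous_empRisk : Continuous P.empRisk := by
  unfold empRisk
  refine continuous_const.mul (continuous_finsetSum _ fun i _ => ?_)
  exact continuous_logisticLoss.comp ((continuous_block i).inner continuous_const)

lemma empRisk_subgradient (w w' : EuclideanSpace ℝ (Fin N × Fin d)) :
    P.empRisk w + inner ℝ (P.riskGrad w) (w' - w) ≤ P.empRisk w' := by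
  have hinner : inner ℝ (P.riskGrad w) (w' - w) = 1 / P.M * ∑ i ∈ P.train,
      -Real.sigmoid (-inner ℝ (block w i) (P.xt i)) *
        (inner ℝ (block w' i) (P.xt i) - inner ℝ (block w i) (P.xt i)) := by
    rw [inner_eq_sum_block, Finset.mul_sum, ← Finset.sum_subset (Finset.subset_univ P.train)]
    · refine Finset.sum_congr rfl fun i hi => ?_
      rw [block_riskGrad, if_pos hi, block_sub, real_inner_smul_left, inner_sub_right,
        real_inner_comm (P.xt i), real_inner_comm (P.xt i)]
      ring
    · intro i _ hi
      rw [block_riskGrad, if_neg hi, inner_zero_left]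
  rw [hinner, empRisk, empRisk, ← mul_add, ← Finset.sum_add_distrib]
  exact mul_le_mul_of_nonneg_left (Finset.sum_le_sum fun i _ => logisticLoss_subgradient _ _)
    (one_div_pos.2 P.M_pos).le

/-! ### The inexact primal step -/

variable {P} in
lemma norm_Phi_sub_le {τ : Fin N → ℝ} {i : Fin N} (hi : i ∈ P.train) (hτ : 0 < τ i)
    (c v v' : EuclideanSpace ℝ (Fin d)) :
    ‖P.Phi τ i c v - P.Phi τ i c v'‖ ≤ P.beta τ i * ‖v - v'‖ := by
  have hβ : 0 ≤ τ i / P.M := (div_pos hτ P.M_pos).le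
  rw [Phi, Phi, add_sub_add_left_eq_sub, ← sub_smul, norm_smul, norm_xt hi, mul_one, ← mul_sub,
    norm_mul, beta_eq, Real.norm_of_nonneg hβ]
  refine mul_le_mul_of_nonneg_left ((abs_sigmoid_sub_le _ _).trans ?_) hβ
  rw [neg_sub_neg, ← inner_sub_left, norm_sub_rev]
  simpa [norm_xt hi] using abs_real_inner_le_norm (v' - v) (P.xt i)

variable {P} in
lemma beta_lt_one {τ : Fin N → ℝ} {i : Fin N} (hτM : τ i < P.M / ‖P.x i‖ ^ 2) :
    P.beta τ i < 1 := by
  rw [beta_eq, div_lt_one P.M_pos]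
  simpa [P.norm_x] using hτM

variable {P} in
lemma exists_Phi_fixedPoint {τ : Fin N → ℝ} {i : Fin N} (hi : i ∈ P.train) (hτ : 0 < τ i)
    (hβ : P.beta τ i < 1) (c : EuclideanSpace ℝ (Fin d)) :
    ∃ v, P.Phi τ i c v = v ∧ ∀ n, ‖(P.Phi τ i c)^[n] c - v‖ ≤ P.beta τ i ^ n := by
  have hβ0 : 0 ≤ P.beta τ i := by
    rw [beta_eq]; exact (div_pos hτ P.M_pos).le
  have hc : ContractingWith ⟨P.beta τ i, hβ0⟩ (P.Phi τ i c) :=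
    ⟨by exact_mod_cast hβ, LipschitzWith.of_dist_le_mul fun v v' => by
      rw [dist_eq_norm, dist_eq_norm]
      exact norm_Phi_sub_le hi hτ c v v'⟩
  obtain ⟨v, hv⟩ : ∃ v, P.Phi τ i c v = v := ⟨_, hc.fixedPoint_isFixedPt⟩
  refine ⟨v, hv, fun n => ?_⟩
  induction n with
  | zero =>
    -- the starting point `c` differs from `v` by `β σ(…) x̃`
    have h : c - v = -((τ i / P.M * Real.sigmoid (-inner ℝ v (P.xt i))) • P.xt i) := by
      nth_rewrite 1 [← hv]
      rw [Phi]
      abel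
    rw [Function.iterate_zero, id, pow_zero, h, norm_neg, norm_smul, norm_xt hi, mul_one, norm_mul,
      Real.norm_of_nonneg (Real.sigmoid_nonneg _), ← beta_eq, Real.norm_of_nonneg hβ0]
    exact mul_le_one₀ hβ.le (Real.sigmoid_nonneg _) (Real.sigmoid_le_one _)
  | succ n ih =>
    rw [Function.iterate_succ_apply', pow_succ']
    nth_rewrite 1 [← hv]
    exact (norm_Phi_sub_le hi hτ c _ _).trans (mul_le_mul_of_nonneg_left ih hβ0)

lemma beta_pow_innerSteps_le {τ : Fin N → ℝ} {i : Fin N} (hτ : 0 < τ i) (hβ : P.beta τ i < 1)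
    {k : ℕ} (hk : 1 ≤ k) : P.beta τ i ^ P.innerSteps τ i k ≤ 1 / (k : ℝ) ^ 2 := by
  have hβ0 : 0 < P.beta τ i := by
    rw [beta_eq]; exact div_pos hτ P.M_pos
  have hk0 : (0 : ℝ) < k := by exact_mod_cast hk
  have hlog : 0 < Real.log (1 / P.beta τ i) := Real.log_pos (by rwa [lt_div_iff₀ hβ0, one_mul])
  have h1 : 2 * Real.log k / Real.log (1 / P.beta τ i) ≤ P.innerSteps τ i k := Nat.le_ceil _
  rw [div_le_iff₀ hlog, one_div, Real.log_inv] at h1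
  rw [← Real.log_le_log_iff (by positivity) (by positivity), Real.log_pow, one_div, Real.log_inv,
    Real.log_pow]
  push_cast
  linarith

lemma block_matVec_T {τ : Fin N → ℝ} (q : EuclideanSpace ℝ (Fin N × Fin d)) (i : Fin N) :
    block (matVec (T d τ) q) i = τ i • block q i := by
  ext a
  simp [block, matVec, T, Matrix.mulVec_diagonal]

lemma posDef_T {τ : Fin N → ℝ} (hτ : ∀ i, 0 < τ i) : (T d τ).PosDef :=
  Matrix.PosDef.diagonal fun ia => hτ ia.1

lemma ext_block {ι : Type*} {u v : EuclideanSpace ℝ (ι × Fin d)}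
    (h : ∀ i, block u i = block v i) : u = v := by
  ext ⟨i, a⟩
  exact congrArg (fun x : EuclideanSpace ℝ (Fin d) => x a) (h i)

variable {P} in
/-- The exact primal update exists and is unique: on a labeled node it is the fixed point of `Φ`,
on an unlabeled node it is `w̄`. The inexact step differs from it by at most `1 / k ^ 2` in each
block. -/
lemma exists_exact_primal_update [DecidableRel G.Adj] {τ : Fin N → ℝ} (hτ : ∀ i, 0 < τ i)
    (hτM : ∀ i ∈ P.train, τ i < P.M / ‖P.x i‖ ^ 2) {k : ℕ} (hk : 1 ≤ k)
    (w : EuclideanSpace ℝ (Fin N × Fin d)) (u : EuclideanSpace ℝ (G.edgeSet × Fin d)) :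
    ∃ p, proxResolvent (T d τ) (fun z => (P.empRisk z : EReal)) (P.wbar τ w u) = {p} ∧
      ∀ i, ‖block (P.inexactPrimalStep τ k w u) i - block p i‖ ≤ 1 / (k : ℝ) ^ 2 := by
  have hfix : ∀ i, ∃ v, i ∈ P.train → P.Phi τ i (block (P.wbar τ w u) i) v = v ∧
      ∀ n, ‖(P.Phi τ i (block (P.wbar τ w u) i))^[n] (block (P.wbar τ w u) i) - v‖ ≤
        P.beta τ i ^ n := fun i => by
    by_cases hi : i ∈ P.train
    · obtain ⟨v, hv⟩ := exists_Phi_fixedPoint hi (hτ i) (beta_lt_one (hτM i hi))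
        (block (P.wbar τ w u) i)
      exact ⟨v, fun _ => hv⟩
    · exact ⟨0, fun h => absurd h hi⟩
  choose v hv using hfix
  let p : EuclideanSpace ℝ (Fin N × Fin d) :=
    WithLp.toLp 2 fun ia => (if ia.1 ∈ P.train then v ia.1 else block (P.wbar τ w u) ia.1) ia.2
  have hp : ∀ i, block p i = if i ∈ P.train then v i else block (P.wbar τ w u) i := fun _ => rfl
  have hmem : p ∈ proxResolvent (T d τ) (fun z => (P.empRisk z : EReal)) (P.wbar τ w u) := by
    refine ⟨P.riskGrad p, mem_subdifferential_coe.2 (P.empRisk_subgradient p),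
      ext_block fun i => ?_⟩
    rw [block_add, block_matVec_T, block_riskGrad, hp]
    split_ifs with hi
    · have h := (hv i hi).1
      rw [Phi] at h
      rw [smul_smul, eq_sub_of_add_eq h, sub_eq_add_neg, ← neg_smul]
      congr 2
      ring
    · rw [smul_zero, add_zero]
  refine ⟨p, Set.eq_singleton_iff_unique_mem.2 ⟨hmem, fun p' hp' =>
    proxResolvent_unique (posDef_T hτ) subdifferential_coe_monotone hp' hmem⟩, fun i => ?_⟩
  have hstep : block (P.inexactPrimalStep τ k w u) i = if i ∈ P.train then
      (P.Phi τ i (block (P.wbar τ w u) i))^[P.innerSteps τ i k] (block (P.wbar τ w u) i)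
      else block (P.wbar τ w u) i := rfl
  rw [hstep, hp]
  split_ifs with hi
  · exact ((hv i hi).2 _).trans (P.beta_pow_innerSteps_le (hτ i) (beta_lt_one (hτM i hi)) hk)
  · rw [sub_self, norm_zero]
    positivity

/-! ### The incidence matrix -/

lemma block_D_mulVec {i j : Fin N} (hij : i < j) {e : G.edgeSet} (he : (e : Sym2 (Fin N)) = s(i, j))
    (w : EuclideanSpace ℝ (Fin N × Fin d)) :
    block (matVec P.D w) e = P.A e • (block w i - block w j) := by
  have hcoef : ∀ k : Fin N, (if ∃ l, (e : Sym2 (Fin N)) = s(k, l) ∧ k < l then P.A e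
      else if ∃ l, (e : Sym2 (Fin N)) = s(k, l) ∧ l < k then -P.A e else 0) =
      P.A e * ((if k = i then 1 else 0) - if k = j then 1 else 0) := by
    intro k
    have h1 : (∃ l, (e : Sym2 (Fin N)) = s(k, l) ∧ k < l) ↔ k = i := by
      rw [he]
      constructor
      · rintro ⟨l, hl, hkl⟩
        rcases Sym2.eq_iff.1 hl with ⟨h, -⟩ | ⟨h, h'⟩
        · exact h.symm
        · subst h h'; exact absurd hkl hij.asymm
      · rintro rfl; exact ⟨j, rfl, hij⟩
    have h2 : (∃ l, (e : Sym2 (Fin N)) = s(k, l) ∧ l < k) ↔ k = j := by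
      rw [he]
      constructor
      · rintro ⟨l, hl, hkl⟩
        rcases Sym2.eq_iff.1 hl with ⟨h, h'⟩ | ⟨h, h'⟩
        · subst h h'; exact absurd hkl hij.asymm
        · exact h'.symm
      · rintro rfl; exact ⟨i, Sym2.eq_swap, hij⟩
    simp only [h1, h2]
    by_cases hki : k = i
    · have hkj : k ≠ j := fun h => hij.ne (hki.symm.trans h)
      simp [hki, hij.ne]
    · by_cases hkj : k = j <;> simp [hki, hkj, hij.ne']
  ext a
  simp only [block, matVec, D, Matrix.mulVec, dotProduct, Matrix.of_apply, Fintype.sum_prod_type,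
    hcoef, Matrix.one_apply]
  simp [mul_sub, sub_mul, Finset.sum_sub_distrib]

/-! ### The dual function -/

/-- The domain `{u | ‖u⁽ᵉ⁾‖ ≤ λ for all e}` of `g*`. -/
def dualBall : Set (EuclideanSpace ℝ (G.edgeSet × Fin d)) :=
  {u | ∀ e, ‖block u e‖ ≤ P.lam}

variable {P} in
lemma mem_dualBall {u : EuclideanSpace ℝ (G.edgeSet × Fin d)} :
    u ∈ P.dualBall ↔ ∀ e, ‖block u e‖ ≤ P.lam := Iff.rfl

lemma zero_mem_dualBall : (0 : EuclideanSpace ℝ (G.edgeSet × Fin d)) ∈ P.dualBall := fun e => by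
  rw [block_zero, norm_zero]
  exact P.lam_nonneg

lemma convex_dualBall : Convex ℝ P.dualBall := fun u hu v hv a b ha hb hab e => by
  rw [block_add, block_smul, block_smul]
  have h := convex_closedBall (0 : EuclideanSpace ℝ (Fin d)) P.lam
    (mem_closedBall_zero_iff.2 (hu e)) (mem_closedBall_zero_iff.2 (hv e)) ha hb hab
  exact mem_closedBall_zero_iff.1 h

variable [DecidableRel G.Adj]

lemma isCompact_dualBall : IsCompact P.dualBall := by
  refine Metric.isCompact_of_isClosed_isBounded ?_ ?_
  · have : P.dualBall = ⋂ e, {u | ‖block u e‖ ≤ P.lam} := by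
      ext u
      simp [mem_dualBall]
    rw [this]
    exact isClosed_iInter fun e => isClosed_le (continuous_block e).norm continuous_const
  · refine isBounded_iff_forall_norm_le.2 ⟨Fintype.card G.edgeSet * P.lam, fun u hu => ?_⟩
    exact norm_le_card_mul_of_block_le P.lam_nonneg hu

variable {P} in
lemma inner_le_g {u : EuclideanSpace ℝ (G.edgeSet × Fin d)} (hu : u ∈ P.dualBall)
    (v : EuclideanSpace ℝ (G.edgeSet × Fin d)) : inner ℝ u v ≤ P.g v := by
  rw [inner_eq_sum_block, g, Finset.mul_sum]
  exact Finset.sum_le_sum fun e _ => (real_inner_le_norm _ _).trans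
    (mul_le_mul_of_nonneg_right (hu e) (norm_nonneg _))

lemma exists_inner_eq_g (v : EuclideanSpace ℝ (G.edgeSet × Fin d)) :
    ∃ u ∈ P.dualBall, inner ℝ u v = P.g v := by
  let u : EuclideanSpace ℝ (G.edgeSet × Fin d) :=
    WithLp.toLp 2 fun ea => ((P.lam * ‖block v ea.1‖⁻¹) • block v ea.1) ea.2
  have hu : ∀ e, block u e = (P.lam * ‖block v e‖⁻¹) • block v e := fun _ => rfl
  refine ⟨u, fun e => ?_, ?_⟩
  · rw [hu, norm_smul, norm_mul, norm_inv, norm_norm, mul_assoc, Real.norm_of_nonneg P.lam_nonneg]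
    exact mul_le_of_le_one_right P.lam_nonneg (inv_mul_le_one_of_le₀ le_rfl (norm_nonneg _))
  · rw [inner_eq_sum_block, g, Finset.mul_sum]
    refine Finset.sum_congr rfl fun e _ => ?_
    rw [hu, real_inner_smul_left, real_inner_self_eq_norm_sq, mul_assoc]
    rcases eq_or_ne ‖block v e‖ 0 with h | h
    · rw [h]; simp
    · rw [sq, inv_mul_cancel_left₀ h]

variable {P} in
lemma convexConjugate_g_of_mem {u : EuclideanSpace ℝ (G.edgeSet × Fin d)} (hu : u ∈ P.dualBall) :
    convexConjugate P.g u = 0 := by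
  refine le_antisymm (iSup_le fun v => ?_) ?_
  · exact_mod_cast sub_nonpos.2 (inner_le_g hu v)
  · refine le_iSup_of_le 0 (le_of_eq ?_)
    simp [g, block_zero]

variable {P} in
/-- Outside its domain `g*` is infinite: it is unbounded along the direction of a block whose norm
exceeds `λ`. -/
lemma convexConjugate_g_of_notMem {u : EuclideanSpace ℝ (G.edgeSet × Fin d)}
    (hu : u ∉ P.dualBall) : convexConjugate P.g u = ⊤ := by
  rw [mem_dualBall] at hu
  push Not at hu
  obtain ⟨e, he⟩ := hu
  set r := ‖block u e‖ with hr
  have hr0 : 0 < r := P.lam_nonneg.trans_lt he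
  refine EReal.eq_top_iff_forall_lt _ |>.2 fun y => ?_
  obtain ⟨t, ht0, ht⟩ : ∃ t : ℝ, 0 ≤ t ∧ y < t * (r * (r - P.lam)) := by
    have hpos : 0 < r * (r - P.lam) := mul_pos hr0 (sub_pos.2 he)
    refine ⟨(|y| + 1) / (r * (r - P.lam)), by positivity, ?_⟩
    rw [div_mul_cancel₀ _ hpos.ne']
    linarith [le_abs_self y]
  let v : EuclideanSpace ℝ (G.edgeSet × Fin d) :=
    WithLp.toLp 2 fun ea => (if ea.1 = e then t • block u e else 0 : EuclideanSpace ℝ (Fin d)) ea.2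
  have hv : ∀ e', block v e' = if e' = e then t • block u e else 0 := fun _ => rfl
  have hval : inner ℝ u v - P.g v = t * (r * (r - P.lam)) := by
    rw [inner_eq_sum_block, g, Finset.sum_eq_single e, Finset.sum_eq_single e]
    · rw [hv, if_pos rfl, real_inner_smul_right, real_inner_self_eq_norm_sq, norm_smul,
        Real.norm_of_nonneg ht0, ← hr]
      ring
    · intro e' _ h
      rw [hv, if_neg h, norm_zero]
    · simp
    · intro e' _ h
      rw [hv, if_neg h, inner_zero_right]
    · simp
  calc (y : EReal) < ((inner ℝ u v - P.g v : ℝ) : EReal) := by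
        rw [hval]; exact_mod_cast ht
    _ ≤ _ := le_iSup (fun x => ((inner ℝ u x - P.g x : ℝ) : EReal)) v

lemma mem_subdifferential_conjugate_g {p q : EuclideanSpace ℝ (G.edgeSet × Fin d)} :
    q ∈ subdifferential (convexConjugate P.g) p ↔
      p ∈ P.dualBall ∧ ∀ c ∈ P.dualBall, inner ℝ q (c - p) ≤ 0 := by
  constructor
  · intro h
    have hp : p ∈ P.dualBall := by
      by_contra hp
      have h0 := h 0
      rw [convexConjugate_g_of_notMem hp, convexConjugate_g_of_mem P.zero_mem_dualBall,
        EReal.top_add_coe] at h0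
      exact absurd h0 (by simp)
    refine ⟨hp, fun c hc => ?_⟩
    have h1 := h c
    rw [convexConjugate_g_of_mem hp, convexConjugate_g_of_mem hc, zero_add] at h1
    exact_mod_cast h1
  · rintro ⟨hp, h⟩ z
    rw [convexConjugate_g_of_mem hp, zero_add]
    by_cases hz : z ∈ P.dualBall
    · rw [convexConjugate_g_of_mem hz]
      exact_mod_cast h z hz
    · rw [convexConjugate_g_of_notMem hz]
      exact le_top

/-- The dual resolvent is the projection onto the domain of `g*` in the metric of `S⁻¹`. -/
lemma mem_proxResolvent_conjugate_g {S : Matrix (G.edgeSet × Fin d) (G.edgeSet × Fin d) ℝ}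
    (hS : S.PosDef) {p v : EuclideanSpace ℝ (G.edgeSet × Fin d)} :
    p ∈ proxResolvent S (convexConjugate P.g) v ↔
      p ∈ P.dualBall ∧ ∀ c ∈ P.dualBall, inner ℝ (matVec S⁻¹ (v - p)) (c - p) ≤ 0 := by
  rw [← mem_subdifferential_conjugate_g]
  constructor
  · rintro ⟨q, hq, rfl⟩
    rwa [add_sub_cancel_left, matVec_inv_cancel_left (posDef_isUnit_det hS)]
  · intro h
    refine ⟨_, h, ?_⟩
    rw [matVec_inv_cancel_right (posDef_isUnit_det hS), add_sub_cancel]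

lemma exists_dual_update {S : Matrix (G.edgeSet × Fin d) (G.edgeSet × Fin d) ℝ} (hS : S.PosDef)
    (v : EuclideanSpace ℝ (G.edgeSet × Fin d)) :
    ∃ p, proxResolvent S (convexConjugate P.g) v = {p} := by
  obtain ⟨p, hp, hpc⟩ := exists_variational_solution P.isCompact_dualBall P.convex_dualBall
    ⟨0, P.zero_mem_dualBall⟩ (matCLM S⁻¹) (inner_matVec_posDef_inv hS) (matVec S⁻¹ v)
  have hmem : p ∈ proxResolvent S (convexConjugate P.g) v := by
    refine (P.mem_proxResolvent_conjugate_g hS).2 ⟨hp, fun c hc => ?_⟩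
    rw [← matCLM_apply, map_sub]
    exact hpc c hc
  refine ⟨p, Set.eq_singleton_iff_unique_mem.2 ⟨hmem, fun p' hp' =>
    proxResolvent_unique hS (fun p₁ p₂ q₁ hq₁ q₂ hq₂ => ?_) hp' hmem⟩⟩
  obtain ⟨hp₁, h₁⟩ := P.mem_subdifferential_conjugate_g.1 hq₁
  obtain ⟨hp₂, h₂⟩ := P.mem_subdifferential_conjugate_g.1 hq₂
  have h1 := h₁ p₂ hp₂
  have h2 := h₂ p₁ hp₁
  rw [← neg_sub p₁ p₂, inner_neg_right] at h1
  rw [inner_sub_left]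
  linarith

/-! ### The objective and its saddle-point form -/

lemma g_D_eq (w : EuclideanSpace ℝ (Fin N × Fin d)) :
    P.g (matVec P.D w) = P.lam * P.totalVariation w := by
  rw [g, totalVariation]
  congr 1
  refine Finset.sum_congr rfl fun e _ => ?_
  obtain ⟨e, heG⟩ := e
  induction e using Sym2.ind with
  | _ i j =>
    have hij : i ≠ j := fun h => G.loopless.irrefl i (by simp [h] at heG)
    simp only [Sym2.lift_mk]
    rcases hij.lt_or_gt with h | h
    · rw [P.block_D_mulVec h rfl, norm_smul, Real.norm_of_nonneg (P.A_pos _).le, norm_sub_rev]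
    · rw [P.block_D_mulVec h Sym2.eq_swap, norm_smul, Real.norm_of_nonneg (P.A_pos _).le]

lemma objective_eq (w : EuclideanSpace ℝ (Fin N × Fin d)) :
    P.objective w = P.empRisk w + P.g (matVec P.D w) := by
  rw [objective, g_D_eq]

variable {P} in
lemma lagrangian_of_mem {u : EuclideanSpace ℝ (G.edgeSet × Fin d)} (hu : u ∈ P.dualBall)
    (w : EuclideanSpace ℝ (Fin N × Fin d)) :
    P.lagrangian w u = ((inner ℝ u (matVec P.D w) + P.empRisk w : ℝ) : EReal) := by
  rw [lagrangian, convexConjugate_g_of_mem hu, sub_zero]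

variable {P} in
lemma isSaddlePoint_of_mem_saddleSet {x : EuclideanSpace ℝ (Fin N × Fin d) ×
    EuclideanSpace ℝ (G.edgeSet × Fin d)}
    (hx : x ∈ saddleSet P.dualBall P.empRisk (matCLM P.D)) : P.IsSaddlePoint x.1 x.2 := by
  obtain ⟨hxC, h1, h2⟩ := hx
  refine ⟨fun u => ?_, fun w => ?_⟩
  · by_cases hu : u ∈ P.dualBall
    · rw [lagrangian_of_mem hu, lagrangian_of_mem hxC, EReal.coe_le_coe_iff]
      have := h1 u hu
      rw [inner_sub_right, real_inner_comm u, real_inner_comm x.2, matCLM_apply] at this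
      linarith
    · rw [lagrangian, convexConjugate_g_of_notMem hu, EReal.sub_top]
      exact bot_le
  · rw [lagrangian_of_mem hxC, lagrangian_of_mem hxC, EReal.coe_le_coe_iff]
    have := h2 w
    simp only [matCLM_apply] at this
    linarith

variable {P} in
lemma isMinOn_of_mem_saddleSet {x : EuclideanSpace ℝ (Fin N × Fin d) ×
    EuclideanSpace ℝ (G.edgeSet × Fin d)}
    (hx : x ∈ saddleSet P.dualBall P.empRisk (matCLM P.D)) :
    IsMinOn P.objective Set.univ x.1 := by
  obtain ⟨hxC, h1, h2⟩ := hx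
  refine isMinOn_univ_iff.2 fun w => ?_
  obtain ⟨c, hc, hcg⟩ := P.exists_inner_eq_g (matVec P.D x.1)
  have h3 := h1 c hc
  rw [inner_sub_right, real_inner_comm c, real_inner_comm x.2] at h3
  have h4 := h2 w
  have h5 := inner_le_g hxC (matVec P.D w)
  simp only [matCLM_apply] at h3 h4
  rw [objective_eq, objective_eq]
  linarith

/-- Strong duality: a minimizer of the objective is the primal part of a saddle point. -/
lemma saddleSet_nonempty (hsol : ∃ w, IsMinOn P.objective Set.univ w) :
    (saddleSet P.dualBall P.empRisk (matCLM P.D)).Nonempty := by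
  obtain ⟨w₀, hw₀⟩ := hsol
  obtain ⟨u, hu, hmin⟩ := exists_multiplier P.isCompact_dualBall P.convex_dualBall
    ⟨0, P.zero_mem_dualBall⟩
    (convexOn_of_subgradient fun w => ⟨P.riskGrad w, P.empRisk_subgradient w⟩)
    P.continuous_empRisk (matCLM P.D) (m := P.objective w₀) (fun w => by
      obtain ⟨c, hc, hcg⟩ := P.exists_inner_eq_g (matVec P.D w)
      refine ⟨c, hc, ?_⟩
      rw [matCLM_apply, hcg, ← objective_eq]
      exact isMinOn_univ_iff.1 hw₀ w)
  have h1 := hmin w₀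
  have h2 := P.objective_eq w₀
  refine ⟨(w₀, u), hu, fun c hc => ?_, fun w => ?_⟩
  · have h3 := inner_le_g hc (matVec P.D w₀)
    rw [inner_sub_right, real_inner_comm c, real_inner_comm u]
    rw [matCLM_apply] at h1 ⊢
    linarith
  · have h3 := inner_le_g hu (matVec P.D w₀)
    have h4 := hmin w
    simp only [matCLM_apply] at h1 h4 ⊢
    linarith

variable {P} in
/-- The limit of an inexact run, as an instance of the abstract convergence theorem for the
primal-dual method. -/
lemma IsInexactRun.exists_tendsto {S : Matrix (G.edgeSet × Fin d) (G.edgeSet × Fin d) ℝ}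
    (hS : S.PosDef) {τ : Fin N → ℝ} (hτ : ∀ i, 0 < τ i)
    (hτM : ∀ i ∈ P.train, τ i < P.M / ‖P.x i‖ ^ 2)
    (hST : precondNorm S P.D (T d τ) < 1) (hsol : ∃ w, IsMinOn P.objective Set.univ w)
    {w : ℕ → EuclideanSpace ℝ (Fin N × Fin d)} {u : ℕ → EuclideanSpace ℝ (G.edgeSet × Fin d)}
    (hrun : P.IsInexactRun S τ w u) :
    ∃ x ∈ saddleSet P.dualBall P.empRisk (matCLM P.D),
      Tendsto w atTop (𝓝 x.1) ∧ Tendsto u atTop (𝓝 x.2) := by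
  have hT : (T d τ).PosDef := posDef_T hτ
  obtain ⟨c, hc, hlow⟩ := exists_coercive_of_precondNorm_lt_one hS hT P.D hST
  have hexact := fun k : ℕ => exists_exact_primal_update hτ hτM (Nat.le_add_left 1 k)
    (w (k + 1)) (u (k + 1))
  choose p hp herr using hexact
  have hsum : Summable fun k : ℕ => (Fintype.card (Fin N) : ℝ) * (1 / ((k + 1 : ℕ) : ℝ) ^ 2) :=
    ((summable_nat_add_iff 1).2 (Real.summable_one_div_nat_pow.2 one_lt_two)).mul_left _
  have hd := fun k => (P.mem_proxResolvent_conjugate_g hS).1 (hrun (k + 1) (Nat.le_add_left 1 k)).2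
  -- the run is indexed from `1`
  have hmain := exists_tendsto_primalDual (Ti := matCLM (T d τ)⁻¹)
    (Si := matCLM S⁻¹) (D := matCLM P.D) (Dt := matCLM P.Dᵀ)
    (inner_matVec_posDef_inv hT) (inner_matVec_posDef_inv hS) (inner_matVec_transpose P.D) hc hlow
    P.isCompact_dualBall P.convex_dualBall P.continuous_empRisk (P.saddleSet_nonempty hsol)
    (w := fun k => w (k + 1)) (u := fun k => u (k + 1)) (p := p) hsum (fun k => ?_) (fun k => ?_)
    (fun k => (hd k).1) (fun k c hc => ?_)
  · obtain ⟨x, hx, hw, hu⟩ := hmain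
    exact ⟨x, hx, (tendsto_add_atTop_iff_nat 1).1 hw, (tendsto_add_atTop_iff_nat 1).1 hu⟩
  · obtain ⟨q, hq, hv⟩ : p k ∈ proxResolvent (T d τ) (fun z => (P.empRisk z : EReal))
        (P.wbar τ (w (k + 1)) (u (k + 1))) := by rw [hp k]; rfl
    have hqe : matCLM (T d τ)⁻¹ (w (k + 1) - p k) - matCLM P.Dᵀ (u (k + 1)) = q := by
      have h1 : w (k + 1) - p k =
          matVec (T d τ) (matVec P.Dᵀ (u (k + 1))) + matVec (T d τ) q := by
        rw [wbar, sub_eq_iff_eq_add] at hv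
        rw [hv]
        abel
      rw [h1, map_add, matCLM_apply, matCLM_apply, matCLM_apply,
        matVec_inv_cancel_left (posDef_isUnit_det hT),
        matVec_inv_cancel_left (posDef_isUnit_det hT), add_sub_cancel_left]
    rw [hqe]
    exact mem_subdifferential_coe.1 hq
  · refine norm_le_card_mul_of_block_le (by positivity) fun i => ?_
    rw [block_sub, (hrun (k + 1) (Nat.le_add_left 1 k)).1]
    exact herr k i
  · have h := (hd k).2 c hc
    rw [add_sub_right_comm, ← matCLM_apply S⁻¹, map_add, matCLM_apply S⁻¹ (matVec S _),
      matVec_inv_cancel_left (posDef_isUnit_det hS)] at h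
    exact h

end LnLasso

end

theorem mainTheorem2 {N d : ℕ} (G : SimpleGraph (Fin N)) [DecidableRel G.Adj] (P : LnLasso G d)
    (S : Matrix (G.edgeSet × Fin d) (G.edgeSet × Fin d) ℝ) (hS : S.PosDef)
    (τ : Fin N → ℝ) (hτ : ∀ i, 0 < τ i)
    (hτM : ∀ i ∈ P.train, τ i < P.M / ‖P.x i‖ ^ 2)
    (hST : precondNorm S P.D (LnLasso.T d τ) < 1)
    (hsol : ∃ w, IsMinOn P.objective Set.univ w) :
    -- the resolvent in the dual update is single-valued and defined everywhere
    (∀ v, ∃ p, proxResolvent S (convexConjugate P.g) v = {p}) ∧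
    ∀ (w : ℕ → EuclideanSpace ℝ (Fin N × Fin d)) (u : ℕ → EuclideanSpace ℝ (G.edgeSet × Fin d)),
      P.IsInexactRun S τ w u →
      -- the error of the inexact primal update
      (∀ k : ℕ, 1 ≤ k →
        ∃ p, proxResolvent (LnLasso.T d τ) (fun z => (P.empRisk z : EReal))
            (P.wbar τ (w k) (u k)) = {p} ∧
          ∀ i, ‖block (w (k + 1)) i - block p i‖ ≤ 1 / (k : ℝ) ^ 2) ∧
      -- convergence to a saddle point, hence to a minimizer
      ∃ (wHat : EuclideanSpace ℝ (Fin N × Fin d)) (uHat : EuclideanSpace ℝ (G.edgeSet × Fin d)),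
        P.IsSaddlePoint wHat uHat ∧
        Filter.Tendsto w Filter.atTop (nhds wHat) ∧
        Filter.Tendsto u Filter.atTop (nhds uHat) ∧
        IsMinOn P.objective Set.univ wHat := by
  refine ⟨P.exists_dual_update hS, fun w u hrun => ⟨fun k hk => ?_, ?_⟩⟩
  · rw [(hrun k hk).1]
    exact LnLasso.exists_exact_primal_update hτ hτM hk (w k) (u k)
  · obtain ⟨x, hx, hw, hu⟩ := hrun.exists_tendsto hS hτ hτM hST hsol
    exact ⟨x.1, x.2, LnLasso.isSaddlePoint_of_mem_saddleSet hx, hw, hu,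
      LnLasso.isMinOn_of_mem_saddleSet hx⟩
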